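/- Let $\mathbb K$ be $\mathbb R$ or $\mathbb C$. For Banach spaces $X,Y$ over $\mathbb K$ let $\mathcal L(X,Y)$ be the space of bounded linear operators from $X$ to $Y$, let $\mathcal F(X,Y)\subseteq\mathcal L(X,Y)$ be the set of operators with finite-dimensional range, and let $\overline{\mathcal F}(X,Y)$ be the closure of $\mathcal F(X,Y)$ in the operator norm (the approximable operators). An operator ideal is a class $\mathcal U$ of bounded linear operators between Banach spaces over $\mathbb K$ whose components $\mathcal U(X,Y)=\mathcal U\cap\mathcal L(X,Y)$ satisfy: (i) $I_{\mathbb K}\in\mathcal U$; (ii) if $S_1,S_2\in\mathcal U(X,Y)$ then $S_1+S_2\in\mathcal U(X,Y)$; (iii) if $T\in\mathcal L(X_0,X)$, $S\in\mathcal U(X,Y)$ and $R\in\mathcal L(Y,Y_0)$ then $RST\in\mathcal U(X_0,Y_0)$. It is symmetric if $\mathcal U=\mathcal U^{dual}$, where $\mathcal U^{dual}$ consists of all $T\in\mathcal L(X,Y)$ whose adjoint $T^*:Y^*\to X^*$, $T^*f=f\circ T$, belongs to $\mathcal U$. **Theorem.** The class $\overline{\mathcal F}$ is an operator ideal, and it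 is symmetric: for all Banach spaces $X,Y$ over $\mathbb K$ and every $T\in\mathcal L(X,Y)$, $$T\in\overline{\mathcal F}(X,Y)\iff T^*\in\overline{\mathcal F}(Y^*,X^*).$$ -/

import Mathlib

universe u

/-- A class of bounded linear operators between Banach spaces over `𝕜`, given by its components:
to every pair of Banach spaces `E`, `F` it assigns a set of bounded operators from `E` to `F`. -/
def OperatorClass (𝕜 : Type) [RCLike 𝕜] : Type (u + 1) :=
  ∀ (E F : Type u) [NormedAddCommGroup E] [NormedSpace 𝕜 E] [CompleteSpace E]
    [NormedAddCommGroup F] [NormedSpace 𝕜 F] [CompleteSpace F], Set (E →L[𝕜] F)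

namespace OperatorClass

variable {𝕜 : Type} [RCLike 𝕜]

/-- Operator ideals. The scalar field enters as the Banach space `ULift 𝕜`, which is `𝕜` itself
placed in the universe of the Banach spaces. -/
structure IsOperatorIdeal (U : OperatorClass.{u} 𝕜) : Prop where
  id_mem : ContinuousLinearMap.id 𝕜 (ULift.{u} 𝕜) ∈ U (ULift.{u} 𝕜) (ULift.{u} 𝕜)
  add_mem : ∀ (E F : Type u) [NormedAddCommGroup E] [NormedSpace 𝕜 E] [CompleteSpace E]
    [NormedAddCommGroup F] [NormedSpace 𝕜 F] [CompleteSpace F] (S₁ S₂ : E →L[𝕜] F),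
    S₁ ∈ U E F → S₂ ∈ U E F → S₁ + S₂ ∈ U E F
  comp_mem : ∀ (E₀ E F F₀ : Type u)
    [NormedAddCommGroup E₀] [NormedSpace 𝕜 E₀] [CompleteSpace E₀]
    [NormedAddCommGroup E] [NormedSpace 𝕜 E] [CompleteSpace E]
    [NormedAddCommGroup F] [NormedSpace 𝕜 F] [CompleteSpace F]
    [NormedAddCommGroup F₀] [NormedSpace 𝕜 F₀] [CompleteSpace F₀]
    (T : E₀ →L[𝕜] E) (S : E →L[𝕜] F) (R : F →L[𝕜] F₀),
    S ∈ U E F → R.comp (S.comp T) ∈ U E₀ F₀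

/-- The Banach space adjoint `T* : F* → E*`, `T* f = f ∘ T`. -/
noncomputable def adjoint {E F : Type u} [NormedAddCommGroup E] [NormedSpace 𝕜 E]
    [NormedAddCommGroup F] [NormedSpace 𝕜 F] (T : E →L[𝕜] F) :
    StrongDual 𝕜 F →L[𝕜] StrongDual 𝕜 E :=
  ContinuousLinearMap.precomp 𝕜 T

/-- The dual class: all operators whose adjoint belongs to the given class. -/
def dual (U : OperatorClass.{u} 𝕜) : OperatorClass.{u} 𝕜 :=
  fun E F _ _ _ _ _ _ => {T | adjoint T ∈ U (StrongDual 𝕜 F) (StrongDual 𝕜 E)}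

/-- A class of operators is symmetric if it coincides with its dual. -/
def IsSymmetric (U : OperatorClass.{u} 𝕜) : Prop := U = U.dual

/-- The closed hull: the closure of every component in the operator norm topology. -/
def closedHull (U : OperatorClass.{u} 𝕜) : OperatorClass.{u} 𝕜 :=
  fun E F _ _ _ _ _ _ => closure (U E F)

/-- The bounded operators of finite rank. -/
def finiteRank (𝕜 : Type) [RCLike 𝕜] : OperatorClass.{u} 𝕜 :=
  fun _ _ _ _ _ _ _ _ => {T | FiniteDimensional 𝕜 T.range}

end OperatorClass

/-!
The ideal properties pass from the finite rank operators to their norm closure by continuity of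
addition and composition, and taking adjoints is continuous and preserves finite rank, because a
finite rank operator factors through some `Fin n → 𝕜`. This leaves one implication: if `T*` is
approximable then so is `T : E → F`.

If `R` has finite rank and `‖T* - R‖ < ε`, write `R f = ∑ j, z j f • c j` with functionals `z j` in
`F**` and `c j` in `E*`. With the canonical embedding `J : F → F**`, this says that
`‖J (T x) - ∑ j, c j x • z j‖ ≤ ε * ‖x‖` for all `x`. The vectors `z j` have to be replaced by
vectors `p j ∈ F` such that `S x = ∑ j, c j x • p j` is still close to `T x` on the unit ball. The
image of the unit ball under
`c` is totally bounded in `Fin n → 𝕜`, so if the norms of the `p j` are bounded in advance by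
`‖z j‖ + 1`, closeness is needed only at finitely many points of the ball. These are finitely many
norm inequalities for the `p j`, which hold strictly in `F**` when `p j` is replaced by `z j`;
`exists_norm_sub_sum_smul_lt`, a form of Helly's theorem that takes the place of the principle of
local reflexivity, says that they are then solvable in `F`.
-/

/-! ### Finite systems of norm inequalities in the bidual -/

section Helly

variable {𝕜 : Type*} [RCLike 𝕜] {E F : Type*} [NormedAddCommGroup E] [NormedSpace 𝕜 E]
  [NormedAddCommGroup F] [NormedSpace 𝕜 F]

theorem StrongDual.exists_norm_lt_mul_norm_le_re (f : StrongDual 𝕜 F) {s r : ℝ} (hs : 0 ≤ s)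
    (hsr : s < r) : ∃ w : F, ‖w‖ < r ∧ s * ‖f‖ ≤ RCLike.re (f w) := by
  have hr : 0 < r := hs.trans_lt hsr
  obtain hf | hf := (norm_nonneg f).eq_or_lt
  · exact ⟨0, by simpa using hr, by simp [← hf]⟩
  · have h : s / r * ‖f‖ < ‖f‖ := mul_lt_of_lt_one_left hf ((div_lt_one hr).2 hsr)
    obtain ⟨x, hx, hfx⟩ := f.exists_lt_apply_of_lt_opNorm h
    obtain ⟨c, hc, hcx⟩ := RCLike.exists_norm_eq_mul_self (f x)
    refine ⟨((r : 𝕜) * c) • x, ?_, ?_⟩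
    · rw [norm_smul, norm_mul, hc, RCLike.norm_of_nonneg hr.le]
      nlinarith
    · rw [map_smul, smul_eq_mul, mul_assoc, ← hcx, ← RCLike.ofReal_mul, RCLike.ofReal_re]
      calc s * ‖f‖ = r * (s / r * ‖f‖) := by field_simp
        _ ≤ r * ‖f x‖ := by gcongr

/-- A functional whose real part is bounded below on a range vanishes there. -/
theorem StrongDual.apply_eq_zero_of_forall_le_re (f : StrongDual 𝕜 F) (A : E →ₗ[𝕜] F) {u : ℝ}
    (h : ∀ x, u ≤ RCLike.re (f (A x))) (x : E) : f (A x) = 0 := by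
  by_contra hx
  have := h ((((u - 1 : ℝ) : 𝕜) / f (A x)) • x)
  rw [map_smul, map_smul, smul_eq_mul, div_mul_cancel₀ _ hx, RCLike.ofReal_re] at this
  linarith

/-- A form of Helly's theorem: if finitely many strict norm inequalities
`‖y i - ∑ j, a i j • z j‖ < r i` are solvable in the bidual, then they are solvable in the space
itself. The hypothesis says that the norm in the bidual is at most `s i < r i`, expressed through
values on functionals. If there is no solution, the open convex set of all `v` with
`‖y i - v i‖ < r i` is separated by some functional from the range of `p ↦ (∑ j, a i j • p j)ᵢ`,
and evaluating `z` at the components of that functional gives a contradiction. -/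
theorem exists_norm_sub_sum_smul_lt {ι κ : Type*} [Fintype ι] [Fintype κ]
    (a : ι → κ → 𝕜) (y : ι → F) (s r : ι → ℝ) (z : κ → StrongDual 𝕜 (StrongDual 𝕜 F))
    (hs : ∀ i, 0 ≤ s i) (hsr : ∀ i, s i < r i)
    (h : ∀ i f, ‖f (y i) - ∑ j, a i j * z j f‖ ≤ s i * ‖f‖) :
    ∃ p : κ → F, ∀ i, ‖y i - ∑ j, a i j • p j‖ < r i := by
  classical
  let : NormedSpace ℝ F := NormedSpace.restrictScalars ℝ 𝕜 F
  have : IsScalarTower ℝ 𝕜 F := RestrictScalars.isScalarTower ℝ 𝕜 F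
  by_contra! hno
  let A : (κ → F) →ₗ[𝕜] (ι → F) :=
    LinearMap.pi fun i => ∑ j, a i j • LinearMap.proj j
  have hA (p : κ → F) (i : ι) : A p i = ∑ j, a i j • p j := by simp [A]
  let D : Set (ι → F) := Set.univ.pi fun i => Metric.ball (y i) (r i)
  have hdisj : Disjoint D (A.range : Set (ι → F)) := by
    rw [Set.disjoint_right]
    rintro _ ⟨p, rfl⟩ hp
    obtain ⟨i, hi⟩ := hno p
    have := hp i trivial
    rw [mem_ball_iff_norm', hA] at this
    exact this.not_ge hi
  obtain ⟨f, u, hfD, hfA⟩ := RCLike.geometric_hahn_banach_open (𝕜 := 𝕜)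
    (convex_pi fun i _ => convex_ball (y i) (r i))
    (isOpen_set_pi Set.finite_univ fun i _ => Metric.isOpen_ball)
    (A.range.restrictScalars ℝ).convex hdisj
  have hu : u ≤ 0 := by simpa using hfA 0 (zero_mem A.range)
  have hf0 := StrongDual.apply_eq_zero_of_forall_le_re f A fun p => hfA (A p) ⟨p, rfl⟩
  let g (i : ι) : StrongDual 𝕜 F := f.comp (ContinuousLinearMap.single 𝕜 (fun _ => F) i)
  have hg (v : ι → F) : f v = ∑ i, g i (v i) := by
    conv_lhs => rw [← Finset.univ_sum_single v, map_sum]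
    rfl
  have hsum (j : κ) : ∑ i, a i j • g i = 0 := by
    ext x
    have := hf0 (Pi.single j x)
    rw [hg] at this
    simpa [hA, Pi.single_apply] using this
  have hz : ∑ i, ∑ j, a i j * z j (g i) = 0 := by
    rw [Finset.sum_comm]
    refine Finset.sum_eq_zero fun j _ => ?_
    rw [← map_zero (z j), ← hsum j, map_sum]
    simp only [map_smul, smul_eq_mul]
  choose w hw hgw using fun i =>
    StrongDual.exists_norm_lt_mul_norm_le_re (g i) (hs i) (hsr i)
  have hneg : RCLike.re (f (y + w)) < 0 :=
    (hfD (y + w) fun i _ => by simpa [mem_ball_iff_norm] using hw i).trans_le hu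
  have hy : -RCLike.re (f y) ≤ ∑ i, s i * ‖g i‖ := by
    have hfy : f y = ∑ i, (g i (y i) - ∑ j, a i j * z j (g i)) := by
      rw [Finset.sum_sub_distrib, hz, sub_zero, hg]
    calc -RCLike.re (f y) ≤ ‖f y‖ := (neg_le_abs _).trans (RCLike.abs_re_le_norm _)
      _ ≤ _ := by
        rw [hfy]
        exact norm_sum_le_of_le _ fun i _ => h i (g i)
  have hwle : ∑ i, s i * ‖g i‖ ≤ RCLike.re (f w) := by
    rw [hg, map_sum]
    exact Finset.sum_le_sum fun i _ => hgw i
  rw [map_add, map_add] at hneg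
  linarith

/-- In the setting of `exists_norm_sub_sum_smul_lt`, there is a solution whose norms exceed those
of the bidual solution by less than `1`: these norm bounds are further inequalities of the same
kind. -/
theorem exists_norm_lt_and_norm_sub_sum_smul_lt {ι κ : Type*} [Fintype ι] [Fintype κ]
    (a : ι → κ → 𝕜) (y : ι → F) (s r : ι → ℝ) (z : κ → StrongDual 𝕜 (StrongDual 𝕜 F))
    (hs : ∀ i, 0 ≤ s i) (hsr : ∀ i, s i < r i)
    (h : ∀ i f, ‖f (y i) - ∑ j, a i j * z j f‖ ≤ s i * ‖f‖) :
    ∃ p : κ → F, (∀ j, ‖p j‖ < ‖z j‖ + 1) ∧ ∀ i, ‖y i - ∑ j, a i j • p j‖ < r i := by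
  classical
  obtain ⟨p, hp⟩ := exists_norm_sub_sum_smul_lt (ι := ι ⊕ κ)
    (Sum.elim a fun k => Pi.single k 1) (Sum.elim y 0) (Sum.elim s fun k => ‖z k‖)
    (Sum.elim r fun k => ‖z k‖ + 1) z (by
      rintro (i | k)
      · exact hs i
      · exact norm_nonneg (z k))
    (by rintro (i | k) <;> simp [hsr]) (by
      rintro (i | k) f
      · exact h i f
      · simpa [Pi.single_apply] using (z k).le_opNorm f)
  exact ⟨p, fun j => by simpa [Pi.single_apply] using hp (Sum.inr j), fun i => hp (Sum.inl i)⟩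

end Helly

/-! ### Finite rank operators -/

section FiniteRank

variable {𝕜 : Type*} [RCLike 𝕜] {E F : Type*} [NormedAddCommGroup E] [NormedSpace 𝕜 E]
  [NormedAddCommGroup F] [NormedSpace 𝕜 F]

theorem ContinuousLinearMap.exists_eq_comp_of_finiteDimensional_range (T : E →L[𝕜] F)
    (hT : FiniteDimensional 𝕜 T.range) :
    ∃ (n : ℕ) (c : E →L[𝕜] (Fin n → 𝕜)) (d : (Fin n → 𝕜) →L[𝕜] F), T = d.comp c := by
  let e : T.range ≃L[𝕜] (Fin (Module.finrank 𝕜 T.range) → 𝕜) :=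
    ContinuousLinearEquiv.ofFinrankEq (by simp)
  refine ⟨_, (e : T.range →L[𝕜] _).comp T.rangeRestrict,
    T.range.subtypeL.comp (e.symm : (Fin (Module.finrank 𝕜 T.range) → 𝕜) →L[𝕜] T.range), ?_⟩
  ext x
  change T x = (e.symm (e (T.rangeRestrict x)) : F)
  rw [e.symm_apply_apply]
  rfl

theorem ContinuousLinearMap.finiteDimensional_range_comp {V : Type*} [NormedAddCommGroup V]
    [NormedSpace 𝕜 V] [FiniteDimensional 𝕜 V] (d : V →L[𝕜] F) (c : E →L[𝕜] V) :
    FiniteDimensional 𝕜 (d.comp c).range :=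
  Submodule.finiteDimensional_of_le (S₂ := d.range) (by
    rintro _ ⟨x, rfl⟩
    exact ⟨c x, rfl⟩)

theorem norm_sum_smul_le_norm_mul_sum {κ : Type*} [Fintype κ] {H : Type*}
    [SeminormedAddCommGroup H] [NormedSpace 𝕜 H] (v : κ → 𝕜) (q : κ → H) :
    ‖∑ j, v j • q j‖ ≤ ‖v‖ * ∑ j, ‖q j‖ := by
  rw [Finset.mul_sum]
  refine norm_sum_le_of_le _ fun j _ => ?_
  rw [norm_smul]
  gcongr
  exact norm_le_pi_norm v j

/-- An operator that is `ε`-close to a finite rank operator `x ↦ ∑ j, c x j • z j` after embedding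
its codomain into the bidual is `6 ε`-close to a finite rank operator into the codomain. Closeness
in the bidual is expressed through values on functionals. -/
theorem ContinuousLinearMap.exists_finiteDimensional_range_norm_sub_le (T : E →L[𝕜] F) {n : ℕ}
    (c : E →L[𝕜] (Fin n → 𝕜)) (z : Fin n → StrongDual 𝕜 (StrongDual 𝕜 F)) {ε : ℝ} (hε : 0 < ε)
    (hT : ∀ x f, ‖f (T x) - ∑ j, c x j * z j f‖ ≤ ε * ‖x‖ * ‖f‖) :
    ∃ S : E →L[𝕜] F, FiniteDimensional 𝕜 S.range ∧ ‖T - S‖ ≤ 6 * ε := by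
  classical
  -- `C` bounds both `∑ j, ‖z j‖` and the corresponding sum for the vectors that replace the `z j`.
  -- The last summand makes it positive when `n = 0`.
  let C : ℝ := ∑ j, (‖z j‖ + 1) + 1
  have hC : 0 < C := by positivity
  have hzC : ∑ j, ‖z j‖ ≤ C :=
    (Finset.sum_le_sum fun j _ => (lt_add_one ‖z j‖).le).trans (lt_add_one _).le
  -- `T` is small on bounded vectors with small image under `c`: a net for `c` serves for `T` too.
  have hTC (x : E) : ‖T x‖ ≤ ε * ‖x‖ + ‖c x‖ * C := by
    obtain ⟨f, hf, hfx⟩ := exists_dual_vector'' 𝕜 (T x)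
    have hcz : ‖∑ j, c x j * z j f‖ ≤ ‖c x‖ * C := by
      refine (norm_sum_smul_le_norm_mul_sum (c x) fun j => z j f).trans ?_
      gcongr
      exact (Finset.sum_le_sum fun j _ => (z j).le_of_opNorm_le_of_le le_rfl hf).trans
        (by simpa using hzC)
    have hfT : ‖f (T x)‖ = ‖T x‖ := by rw [hfx, RCLike.norm_ofReal, abs_norm]
    linarith [norm_le_norm_sub_add (f (T x)) (∑ j, c x j * z j f),
      (hT x f).trans (mul_le_of_le_one_right (by positivity) hf)]
  obtain ⟨t, htB, htfin, htcov⟩ := Metric.finite_approx_of_totallyBounded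
    ((c.lipschitz.isBounded_image
      (Metric.isBounded_closedBall (x := (0 : E)) (r := 1))).isCompact_closure.totallyBounded.subset
        subset_closure)
    (ε / C) (by positivity)
  have := htfin.fintype
  choose x hxB hx using fun v : t => htB v.2
  obtain ⟨p, hpz, hpT⟩ := exists_norm_lt_and_norm_sub_sum_smul_lt (ι := t)
    (fun v => c (x v)) (fun v => T (x v)) (fun _ => ε) (fun _ => 2 * ε) z (fun _ => hε.le)
    (fun _ => by linarith) fun v f => by
      have hv : ‖x v‖ ≤ 1 := by simpa using hxB v
      exact (hT (x v) f).trans (by gcongr; exact mul_le_of_le_one_right hε.le hv)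
  have hpC : ∑ j, ‖p j‖ ≤ C :=
    (Finset.sum_le_sum fun j _ => (hpz j).le).trans (lt_add_one _).le
  let q : (Fin n → 𝕜) →L[𝕜] F :=
    ∑ j, (ContinuousLinearMap.proj (R := 𝕜) (φ := fun _ : Fin n => 𝕜) j).smulRight (p j)
  have hq (v : Fin n → 𝕜) : q v = ∑ j, v j • p j := by simp [q, sum_apply]
  refine ⟨q.comp c, finiteDimensional_range_comp q c,
    ContinuousLinearMap.opNorm_le_of_unit_norm (by positivity) fun x₀ hx₀ => ?_⟩
  obtain ⟨v, hvt, hv⟩ := Set.mem_iUnion₂.1 (htcov ⟨x₀, by simp [hx₀], rfl⟩)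
  obtain ⟨x₁, hx₁, hcx₁, hpx₁⟩ : ∃ x₁, ‖x₁‖ ≤ 1 ∧ c x₁ = v ∧
      ‖T x₁ - ∑ j, c x₁ j • p j‖ ≤ 2 * ε :=
    ⟨x ⟨v, hvt⟩, by simpa using hxB ⟨v, hvt⟩, hx ⟨v, hvt⟩, (hpT ⟨v, hvt⟩).le⟩
  have hcC : ‖c (x₀ - x₁)‖ * C ≤ ε := by
    rw [map_sub, hcx₁, ← dist_eq_norm]
    exact (le_div_iff₀ hC).1 (Metric.mem_ball.1 hv).le
  have hTx : ‖T (x₀ - x₁)‖ ≤ 3 * ε := by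
    have hx₀₁ : ‖x₀ - x₁‖ ≤ 2 := (norm_sub_le _ _).trans (by linarith)
    linarith [hTC (x₀ - x₁), mul_le_mul_of_nonneg_left hx₀₁ hε.le]
  have hqx : ‖q (c (x₀ - x₁))‖ ≤ ε := by
    rw [hq]
    exact (norm_sum_smul_le_norm_mul_sum _ _).trans
      ((mul_le_mul_of_nonneg_left hpC (norm_nonneg _)).trans hcC)
  rw [← hq] at hpx₁
  have hsplit : (T - q.comp c) x₀ =
      T (x₀ - x₁) + (T x₁ - q (c x₁)) - q (c (x₀ - x₁)) := by
    simp only [sub_apply, ContinuousLinearMap.comp_apply, map_sub]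
    abel
  -- The three terms contribute `3 * ε`, `2 * ε` and `ε`.
  rw [hsplit]
  linarith [norm_sub_le (T (x₀ - x₁) + (T x₁ - q (c x₁))) (q (c (x₀ - x₁))),
    norm_add_le (T (x₀ - x₁)) (T x₁ - q (c x₁))]

end FiniteRank

/-! ### Approximable operators -/

namespace OperatorClass

variable {𝕜 : Type} [RCLike 𝕜]

theorem closedHull_finiteRank_isOperatorIdeal :
    (finiteRank.{u} 𝕜).closedHull.IsOperatorIdeal where
  id_mem := by
    apply subset_closure
    change FiniteDimensional 𝕜 (ContinuousLinearMap.id 𝕜 (ULift.{u} 𝕜)).range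
    have : FiniteDimensional 𝕜 (ULift.{u} 𝕜) := ULift.moduleEquiv.symm.finiteDimensional
    infer_instance
  add_mem E F _ _ _ _ _ _ S₁ S₂ h₁ h₂ := by
    refine map_mem_closure₂ continuous_add h₁ h₂ fun A hA B hB => ?_
    have : FiniteDimensional 𝕜 A.range := hA
    have : FiniteDimensional 𝕜 B.range := hB
    exact Submodule.finiteDimensional_of_le (S₂ := A.range ⊔ B.range) (by
      rintro _ ⟨x, rfl⟩
      exact Submodule.add_mem_sup ⟨x, rfl⟩ ⟨x, rfl⟩)
  comp_mem E₀ E F F₀ _ _ _ _ _ _ _ _ _ _ _ _ T S R h := by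
    refine map_mem_closure (f := fun S : E →L[𝕜] F => R.comp (S.comp T)) (by fun_prop) h
      fun A hA => ?_
    obtain ⟨n, c, d, rfl⟩ := A.exists_eq_comp_of_finiteDimensional_range hA
    exact (R.comp d).finiteDimensional_range_comp (c.comp T)

variable {E F : Type u} [NormedAddCommGroup E] [NormedSpace 𝕜 E] [CompleteSpace E]
  [NormedAddCommGroup F] [NormedSpace 𝕜 F] [CompleteSpace F]

theorem adjoint_mem_closedHull_finiteRank {T : E →L[𝕜] F}
    (hT : T ∈ (finiteRank.{u} 𝕜).closedHull E F) :
    adjoint T ∈ (finiteRank.{u} 𝕜).closedHull (StrongDual 𝕜 F) (StrongDual 𝕜 E) := by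
  refine map_mem_closure (f := adjoint) ((ContinuousLinearMap.compL 𝕜 E F 𝕜).flip.continuous) hT
    fun A hA => ?_
  obtain ⟨n, c, d, rfl⟩ := A.exists_eq_comp_of_finiteDimensional_range hA
  exact ContinuousLinearMap.finiteDimensional_range_comp (E := StrongDual 𝕜 F)
    (F := StrongDual 𝕜 E) (V := StrongDual 𝕜 (Fin n → 𝕜))
    (ContinuousLinearMap.precomp 𝕜 c) (ContinuousLinearMap.precomp 𝕜 d)

theorem mem_closedHull_finiteRank_of_adjoint {T : E →L[𝕜] F}
    (hT : adjoint T ∈ (finiteRank.{u} 𝕜).closedHull (StrongDual 𝕜 F) (StrongDual 𝕜 E)) :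
    T ∈ (finiteRank.{u} 𝕜).closedHull E F := by
  refine Metric.mem_closure_iff.2 fun ε hε => ?_
  -- `7` in place of the constant `6` gives the strict inequality.
  obtain ⟨R, hR, hTR⟩ := Metric.mem_closure_iff.1 hT (ε / 7) (by positivity)
  obtain ⟨n, a, b, rfl⟩ := R.exists_eq_comp_of_finiteDimensional_range hR
  rw [dist_eq_norm] at hTR
  -- The approximant is `f ↦ ∑ j, a f j • b (e j)` for the standard basis `e`, so the bidual
  -- vectors are the coordinates of `a`.
  obtain ⟨S, hS, hTS⟩ := T.exists_finiteDimensional_range_norm_sub_le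
    (ContinuousLinearMap.pi fun j => b (Pi.single j 1))
    (fun j => (ContinuousLinearMap.proj (R := 𝕜) (φ := fun _ : Fin n => 𝕜) j).comp a)
    (ε := ε / 7) (by positivity) fun x f => by
      have hb : b (a f) x = ∑ j, a f j * b (Pi.single j 1) x := by
        conv_lhs => rw [pi_eq_sum_univ' (a f), map_sum]
        simp only [map_smul, sum_apply, smul_apply, smul_eq_mul]
      calc _ = ‖(adjoint T - b.comp a) f x‖ := by
            congr 1
            simp only [sub_apply, ContinuousLinearMap.comp_apply, hb]
            exact congrArg (f (T x) - ·) (Finset.sum_congr rfl fun j _ => mul_comm _ _)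
        _ ≤ ‖adjoint T - b.comp a‖ * ‖f‖ * ‖x‖ := ContinuousLinearMap.le_opNorm₂ _ f x
        _ ≤ ε / 7 * ‖f‖ * ‖x‖ := by gcongr
        _ = ε / 7 * ‖x‖ * ‖f‖ := by ring
  refine ⟨S, hS, ?_⟩
  rw [dist_eq_norm]
  linarith

end OperatorClass

theorem theorem2p3 (𝕜 : Type) [RCLike 𝕜] :
    (OperatorClass.finiteRank.{u} 𝕜).closedHull.IsOperatorIdeal ∧
      (OperatorClass.finiteRank.{u} 𝕜).closedHull.IsSymmetric := by
  refine ⟨OperatorClass.closedHull_finiteRank_isOperatorIdeal, ?_⟩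
  funext E F _ _ _ _ _ _
  ext T
  exact ⟨OperatorClass.adjoint_mem_closedHull_finiteRank,
    OperatorClass.mem_closedHull_finiteRank_of_adjoint⟩
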